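/- Let $H_A$, $H_B$, $H$ be complex Hilbert spaces. A linear relation $R$ from $E$ to $F$ is a linear subspace of $E\times F$; it is closed if it is a closed subspace. Write $\operatorname{dom}R=\{f:(f,f')\in R \text{ for some } f'\}$, $\operatorname{mul}R=\{f':(0,f')\in R\}$, $R^*=\{(g,g'):\langle f',g\rangle=\langle f,g'\rangle \text{ for all }(f,f')\in R\}$, $rR=\{(f,rf'):(f,f')\in R\}$ for $r \in \mathbb R$, $SR=\{(f,f'):(f,\varphi)\in R,\ (\varphi,f')\in S\text{ for some }\varphi\}$, and let $R_s=\{(f,f')\in R: f'\perp\operatorname{mul}R\}$ be the operator part of $R$. Operators are identified with their graphs. A relation $R$ in $H$ is nonnegative selfadjoint if $R=R^*$ and $\langle f',f\rangle\ge 0$ for all $(f,f')\in R$; then $R^{1/2}$ denotes the nonnegative selfadjoint relation $K$ with $K^2=R$, and $R_s^{1/2}:=(R^{1/2})_s$. For nonnegative selfadjoint relations $R_1,R_2$ in $H$, $R_1\le R_2$ means that $$\operatorname{dom}R_{2s}^{1/2}\subset\operatorname{dom}R_{1s}^{1/2}\quad\text{and}\quad \|R_{1s}^{1/2}h\|\le\|R_{2s}^{1/2}h\|\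 \text{ for all }h\in\operatorname{dom}R_{2}^{1/2};$$ an inequality $R_1\le R_2$ includes the assertion that $R_1$ and $R_2$ are nonnegative selfadjoint. **Theorem.** Let $A$ be a closed linear relation from $H_A$ to $H$ and $B$ a closed linear relation from $H_B$ to $H$. Then there exists a bounded everywhere defined operator $W\in\mathbf B(H_A,H_B)$ (or, equivalently, an operator $W\in\mathbf B(\overline{\operatorname{dom}}A,\overline{\operatorname{dom}}B)$) such that $$A\subset BW$$ if and only if there exists $c\ge 0$ such that $$AA^*\le c^2BB^*.$$ Moreover, whenever $c\ge0$ and $AA^*\le c^2BB^*$, one can take $W$, in either of the two classes of operators, with $\|W\|\le c$. -/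

import Mathlib

/-! Linear relations between complex Hilbert spaces, i.e. linear subspaces of `E × F`.
The adjoint relation is `Submodule.adjoint`:
`(g, g') ∈ R.adjoint` iff `⟪f', g⟫ = ⟪f, g'⟫` for all `(f, f') ∈ R`. -/

/-- A linear relation from `E` to `F`: a linear subspace of `E × F`. -/
abbrev LinRel (E F : Type*) [AddCommGroup E] [Module ℂ E] [AddCommGroup F] [Module ℂ F] :=
  Submodule ℂ (E × F)

namespace LinRel

section Algebra

variable {E F G : Type*} [AddCommGroup E] [Module ℂ E] [AddCommGroup F] [Module ℂ F]
  [AddCommGroup G] [Module ℂ G]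

/-- The domain `{f : (f, f') ∈ R for some f'}`. -/
def dom (R : LinRel E F) : Submodule ℂ E := Submodule.map (LinearMap.fst ℂ E F) R

/-- The multivalued part `{f' : (0, f') ∈ R}`. -/
def mul (R : LinRel E F) : Submodule ℂ F := Submodule.comap (LinearMap.inr ℂ E F) R

/-- The product `S R = {(f, f') : (f, φ) ∈ R and (φ, f') ∈ S for some φ}`. -/
def prod (S : LinRel F G) (R : LinRel E F) : LinRel E G where
  carrier := {p | ∃ φ : F, (p.1, φ) ∈ R ∧ (φ, p.2) ∈ S}
  zero_mem' := ⟨0, R.zero_mem, S.zero_mem⟩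
  add_mem' := by
    rintro p q ⟨φ, h₁, h₂⟩ ⟨ψ, h₃, h₄⟩
    exact ⟨φ + ψ, R.add_mem h₁ h₃, S.add_mem h₂ h₄⟩
  smul_mem' := by
    rintro c p ⟨φ, h₁, h₂⟩
    exact ⟨c • φ, R.smul_mem c h₁, S.smul_mem c h₂⟩

/-- The scalar multiple `r R = {(f, r f') : (f, f') ∈ R}`. -/
def scale (r : ℝ) (R : LinRel E F) : LinRel E F :=
  Submodule.map (LinearMap.prodMap LinearMap.id ((r : ℂ) • LinearMap.id)) R

end Algebra

section Hilbert

variable {E F : Type*} [NormedAddCommGroup E] [InnerProductSpace ℂ E]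
  [NormedAddCommGroup F] [InnerProductSpace ℂ F]

/-- The graph `{(x, W x)}` of a bounded everywhere defined operator, as a relation. -/
def ofOp (W : E →L[ℂ] F) : LinRel E F := (W : E →ₗ[ℂ] F).graph

/-- The graph `{(x, W x) : x ∈ M}` of a bounded operator `W` from the subspace `M` of `E` to the
subspace `N` of `F`, as a relation from `E` to `F`. -/
def ofOpOn {M : Submodule ℂ E} {N : Submodule ℂ F} (W : M →L[ℂ] N) : LinRel E F :=
  Submodule.map (LinearMap.prodMap M.subtype N.subtype) (W : M →ₗ[ℂ] N).graph

/-- The (orthogonal) operator part `R ⊖ ({0} × mul R)`: the pairs of `R` whose second component is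
orthogonal to `mul R`. -/
noncomputable def opPart (R : LinRel E F) : LinRel E F :=
  R ⊓ Submodule.comap (LinearMap.snd ℂ E F) (mul R)ᗮ

/-- A nonnegative selfadjoint relation: `R = R*` and `(f', f) ≥ 0` for all `(f, f') ∈ R`. -/
structure IsNonnegSelfAdjoint (R : LinRel E E) : Prop where
  selfAdjoint : R.adjoint = R
  nonneg : ∀ f f' : E, (f, f') ∈ R → 0 ≤ (inner ℂ f f').re ∧ (inner ℂ f f').im = 0

/-- `K` is the square root of `R`: `K` is nonnegative and selfadjoint, and `K K = R`. -/
structure IsSqrt (K R : LinRel E E) : Prop where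
  nonnegSelfAdjoint : IsNonnegSelfAdjoint K
  sq : prod K K = R

/-- The order on nonnegative selfadjoint relations: `R₁ ≤ R₂` if, for the square roots `K₁`, `K₂`
of `R₁`, `R₂` and their operator parts, `dom (K₂)ₛ ⊆ dom (K₁)ₛ` and `‖(K₁)ₛ h‖ ≤ ‖(K₂)ₛ h‖` for all
`h ∈ dom K₂`. -/
def FormLE (R₁ R₂ : LinRel E E) : Prop :=
  IsNonnegSelfAdjoint R₁ ∧ IsNonnegSelfAdjoint R₂ ∧
    ∃ K₁ K₂ : LinRel E E, IsSqrt K₁ R₁ ∧ IsSqrt K₂ R₂ ∧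
      dom (opPart K₂) ≤ dom (opPart K₁) ∧
      ∀ h k₁ k₂ : E, (h, k₁) ∈ opPart K₁ → (h, k₂) ∈ opPart K₂ → ‖k₁‖ ≤ ‖k₂‖

end Hilbert

end LinRel

/-! Everything happens on the adjoint side. If `A ⊂ BW`, then `W* B* ⊂ A*`: for `(h, b) ∈ B*` the
pair `(h, W* b)` lies in `A*`, so the operator part of `A*` at `h` has norm at most `‖W‖ ‖b‖`.
Conversely, such a bound makes `b ↦ a` a bounded operator `V`, and `W = V*` works because `B = B**`
(`exists_contraction_iff_formLE`).

The order is defined through square roots. A root `K` of `A A*` satisfies `K* K = A** A*`, and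
closed relations with equal `T* T` have operator parts with equal domains and norms
(`exists_mem_opPart_of_prod_adjoint_eq`), so `K` may be replaced by `A*`
(`formLE_prod_adjoint_iff`). Roots exist (`exists_isSqrt`) by functional calculus on the resolvent
`(1 + R)⁻¹`. Replacing `B` by `c B` reduces `c > 0` to contractions; `c = 0` is separate. -/

namespace LinRel

/-! ### Adjoints, operator parts and the relation `T* T`. -/

section Adjoint

variable {E F : Type*} [NormedAddCommGroup E] [InnerProductSpace ℂ E]
  [NormedAddCommGroup F] [InnerProductSpace ℂ F]

theorem mem_adjoint {R : LinRel E F} {g : F} {g' : E} :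
    (g, g') ∈ R.adjoint ↔ ∀ f f', (f, f') ∈ R → inner ℂ f' g = inner ℂ f g' := by
  simp [Submodule.mem_adjoint_iff, sub_eq_zero]

theorem isClosed_adjoint (R : LinRel E F) : IsClosed (R.adjoint : Set (F × E)) := by
  rw [Submodule.adjoint]
  simp only [Submodule.map_coe]
  rw [LinearEquiv.coe_coe, LinearEquiv.image_eq_preimage_symm]
  exact (Submodule.isClosed_orthogonal _).preimage (WithLp.prod_continuous_toLp _ _ _)

/-- Orthogonal projection onto a closed relation, in terms of components. -/
theorem exists_orthogonal_decomposition [CompleteSpace E] [CompleteSpace F] {T : LinRel E F}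
    (hT : IsClosed (T : Set (E × F))) (x : E) (y : F) :
    ∃ p p' q q', (p, p') ∈ T ∧ x = p + q ∧ y = p' + q' ∧
      ∀ t t', (t, t') ∈ T → inner ℂ t q + inner ℂ t' q' = 0 := by
  -- `E × F` carries the sup norm; orthogonality needs the Hilbert sum.
  let M : Submodule ℂ (WithLp 2 (E × F)) :=
    T.comap (WithLp.linearEquiv 2 ℂ (E × F) : WithLp 2 (E × F) →ₗ[ℂ] E × F)
  have hM : IsClosed (M : Set (WithLp 2 (E × F))) :=
    hT.preimage (WithLp.prod_continuous_ofLp _ _ _)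
  have : CompleteSpace M := hM.completeSpace_coe
  obtain ⟨p, hp, q, hq, h⟩ := M.exists_add_mem_mem_orthogonal (WithLp.toLp 2 (x, y))
  refine ⟨p.fst, p.snd, q.fst, q.snd, hp, ?_, ?_, fun t t' ht => ?_⟩
  · simpa using congrArg (fun z => WithLp.fst z) h
  · simpa using congrArg (fun z => WithLp.snd z) h
  · exact (M.mem_orthogonal q).1 hq (WithLp.toLp 2 (t, t')) ht

theorem eq_zero_of_inner_add_inner {q : E} {q' : F}
    (h : inner ℂ q q + inner ℂ q' q' = 0) : q = 0 ∧ q' = 0 := by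
  have h' := congrArg (RCLike.re : ℂ → ℝ) h
  rw [map_add, inner_self_eq_norm_sq, inner_self_eq_norm_sq, map_zero] at h'
  constructor
  · exact norm_eq_zero.1 (pow_eq_zero_iff two_ne_zero |>.1
      (by nlinarith [sq_nonneg ‖q‖, sq_nonneg ‖q'‖]))
  · exact norm_eq_zero.1 (pow_eq_zero_iff two_ne_zero |>.1
      (by nlinarith [sq_nonneg ‖q‖, sq_nonneg ‖q'‖]))

/-- The adjoint is the orthogonal complement rotated by `(q, q') ↦ (q', -q)`. -/
theorem mem_adjoint_of_orthogonal {T : LinRel E F} {q : E} {q' : F}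
    (h : ∀ t t', (t, t') ∈ T → inner ℂ t q + inner ℂ t' q' = 0) : (q', -q) ∈ T.adjoint :=
  mem_adjoint.2 fun f f' hf => by
    rw [inner_neg_right]; linear_combination h f f' hf

theorem adjoint_adjoint [CompleteSpace E] [CompleteSpace F] {T : LinRel E F}
    (hT : IsClosed (T : Set (E × F))) : T.adjoint.adjoint = T := by
  ext ⟨x, y⟩
  constructor
  · intro h
    obtain ⟨p, p', q, q', hp, rfl, rfl, hq⟩ := exists_orthogonal_decomposition hT x y
    have h1 := mem_adjoint.1 h _ _ (mem_adjoint_of_orthogonal hq)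
    have h2 := hq _ _ hp
    have h3 : inner ℂ q p + inner ℂ q' p' = 0 := by
      rw [← inner_conj_symm q, ← inner_conj_symm q', ← map_add, h2, map_zero]
    simp only [inner_add_right, inner_neg_left] at h1
    obtain ⟨rfl, rfl⟩ := eq_zero_of_inner_add_inner (q := q) (q' := q') (by
      linear_combination -h1 - h3)
    simpa using hp
  · intro h
    refine mem_adjoint.2 fun f f' hf => ?_
    rw [← inner_conj_symm, ← inner_conj_symm f, mem_adjoint.1 hf _ _ h]

theorem inner_eq_of_mem_adjoint {T : LinRel E F} {x : E} {y : F} {u : F} {v : E}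
    (h : (x, y) ∈ T) (h' : (u, v) ∈ T.adjoint) : inner ℂ y u = inner ℂ x v :=
  mem_adjoint.1 h' _ _ h

theorem mem_prod {G : Type*} [AddCommGroup G] [Module ℂ G] {S : LinRel F G} {R : LinRel E F}
    {x : E} {y : G} : (x, y) ∈ prod S R ↔ ∃ φ, (x, φ) ∈ R ∧ (φ, y) ∈ S := Iff.rfl

theorem mem_mul {T : LinRel E F} {y : F} : y ∈ mul T ↔ ((0 : E), y) ∈ T := Iff.rfl

theorem mem_opPart {T : LinRel E F} {x : E} {y : F} :
    (x, y) ∈ opPart T ↔ (x, y) ∈ T ∧ ∀ m, ((0 : E), m) ∈ T → inner ℂ m y = 0 := by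
  simp only [opPart, Submodule.mem_inf, Submodule.mem_comap, LinearMap.snd_apply,
    Submodule.mem_orthogonal, mem_mul]

theorem mem_dom {E F : Type*} [AddCommGroup E] [Module ℂ E] [AddCommGroup F] [Module ℂ F]
    {T : LinRel E F} {x : E} : x ∈ dom T ↔ ∃ y, (x, y) ∈ T := by
  simp [dom]

theorem mem_scale {r : ℝ} {T : LinRel E F} {x : E} {y : F} :
    (x, y) ∈ scale r T ↔ ∃ z, (x, z) ∈ T ∧ y = (r : ℂ) • z := by
  simp [scale, eq_comm]

theorem opPart_unique {T : LinRel E F} {x : E} {y z : F} (hy : (x, y) ∈ opPart T)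
    (hz : (x, z) ∈ opPart T) : y = z := by
  have h := sub_mem hy hz
  rw [Prod.mk_sub_mk, sub_self, mem_opPart] at h
  exact sub_eq_zero.1 (inner_self_eq_zero.1 (h.2 _ h.1))

/-- Subtracting from `y` its projection on the closed space `mul T` stays in `T` and does not
increase the norm. -/
theorem exists_mem_opPart [CompleteSpace F] {T : LinRel E F} (hT : IsClosed (T : Set (E × F)))
    {x : E} {y : F} (h : (x, y) ∈ T) : ∃ z, (x, z) ∈ opPart T ∧ ‖z‖ ≤ ‖y‖ := by
  have hm : IsClosed (mul T : Set F) :=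
    hT.preimage (by fun_prop : Continuous fun y : F => ((0 : E), y))
  have : CompleteSpace (mul T) := hm.completeSpace_coe
  obtain ⟨m, hm, z, hz, rfl⟩ := (mul T).exists_add_mem_mem_orthogonal y
  refine ⟨z, mem_opPart.2 ⟨?_, fun n hn => (Submodule.mem_orthogonal _ _).1 hz n hn⟩, ?_⟩
  · simpa using sub_mem h (mem_mul.1 hm)
  · have h0 : inner ℂ m z = 0 := (Submodule.mem_orthogonal _ _).1 hz m hm
    have := norm_add_sq_eq_norm_sq_add_norm_sq_of_inner_eq_zero m z h0
    nlinarith [norm_nonneg m, norm_nonneg z, norm_nonneg (m + z)]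

/-- `ran (1 + T* T)` is the whole space. -/
theorem exists_add_eq_of_isClosed [CompleteSpace E] [CompleteSpace F] {T : LinRel E F}
    (hT : IsClosed (T : Set (E × F))) (u : E) :
    ∃ h φ h', (h, φ) ∈ T ∧ (φ, h') ∈ T.adjoint ∧ h + h' = u := by
  -- The residual of `(u, 0)` is `(q, -p')`; its orthogonality to `T` says `(p', q) ∈ T*`.
  obtain ⟨p, p', q, q', hp, h1, h2, hq⟩ := exists_orthogonal_decomposition hT u 0
  refine ⟨p, p', q, hp, ?_, h1.symm⟩
  have := neg_mem (mem_adjoint_of_orthogonal hq)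
  rw [eq_neg_of_add_eq_zero_left h2.symm]
  simpa using this

theorem inner_of_mem_prod_adjoint {T : LinRel E F} {h : E} {φ : F} {h' : E}
    (h1 : (h, φ) ∈ T) (h2 : (φ, h') ∈ T.adjoint) : inner ℂ h h' = ((‖φ‖ ^ 2 : ℝ) : ℂ) := by
  rw [← inner_eq_of_mem_adjoint h1 h2, inner_self_eq_norm_sq_to_K]; norm_cast

/-- `T* T` is symmetric and `1 + T* T` is onto, which forces selfadjointness. -/
theorem isNonnegSelfAdjoint_prod_adjoint [CompleteSpace E] [CompleteSpace F] {T : LinRel E F}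
    (hT : IsClosed (T : Set (E × F))) : IsNonnegSelfAdjoint (prod T.adjoint T) := by
  refine ⟨?_, ?_⟩
  · have hle : prod T.adjoint T ≤ (prod T.adjoint T).adjoint := by
      rintro ⟨g, g'⟩ ⟨ψ, h1, h2⟩
      refine mem_adjoint.2 ?_
      rintro f f' ⟨φ, h3, h4⟩
      rw [← inner_eq_of_mem_adjoint h3 h2, ← inner_conj_symm, ← inner_eq_of_mem_adjoint h1 h4,
        inner_conj_symm]
    refine le_antisymm ?_ hle
    rintro ⟨g, g'⟩ hg
    obtain ⟨h, φ, h', h1, h2, h3⟩ := exists_add_eq_of_isClosed hT (g + g')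
    have hh : (h, h') ∈ prod T.adjoint T := ⟨φ, h1, h2⟩
    -- The difference has the form `(d, -d)` and lies in the adjoint; testing it on a pair of `T* T`
    -- with sum `d` gives `⟪d, d⟫ = 0`.
    have hk := sub_mem hg (hle hh)
    have hk' : g' - h' = -(g - h) := by
      rw [eq_neg_iff_add_eq_zero, sub_add_sub_comm, add_comm g', add_comm h', h3, sub_self]
    rw [Prod.mk_sub_mk, hk'] at hk
    obtain ⟨p, φ', p', h4, h5, h6⟩ := exists_add_eq_of_isClosed hT (g - h)
    have := mem_adjoint.1 hk p p' ⟨φ', h4, h5⟩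
    have h0 : inner ℂ (g - h) (g - h) = (0 : ℂ) := by
      nth_rw 1 [← h6]
      rw [inner_add_left, this, inner_neg_right, add_neg_cancel]
    rw [inner_self_eq_zero.1 h0, neg_zero] at hk'
    rw [sub_eq_zero.1 (inner_self_eq_zero.1 h0), sub_eq_zero.1 hk']
    exact hh
  · rintro f f' ⟨φ, h1, h2⟩
    rw [inner_of_mem_prod_adjoint h1 h2]
    exact ⟨by rw [Complex.ofReal_re]; positivity, Complex.ofReal_im _⟩

/-- The pairs `(h, φ)` of `T` with `φ ∈ dom T*` are dense in the operator part of `T`. -/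
theorem exists_seq_tendsto_of_mem_opPart [CompleteSpace E] [CompleteSpace F] {T : LinRel E F}
    (hT : IsClosed (T : Set (E × F))) {x : E} {y : F} (h : (x, y) ∈ opPart T) :
    ∃ (u : ℕ → E) (v : ℕ → F) (w : ℕ → E), (∀ n, (u n, v n) ∈ T) ∧
      (∀ n, (v n, w n) ∈ T.adjoint) ∧ Filter.Tendsto u Filter.atTop (nhds x) ∧
      Filter.Tendsto v Filter.atTop (nhds y) := by
  let D : LinRel E F := T ⊓ Submodule.comap (LinearMap.snd ℂ E F) (dom T.adjoint)
  have hDT : D.topologicalClosure ≤ opPart T := by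
    intro p hp
    have hclT : D.topologicalClosure ≤ T :=
      Submodule.topologicalClosure_minimal _ inf_le_left hT
    refine mem_opPart.2 ⟨hclT hp, fun m hm => ?_⟩
    have hcl : IsClosed {p : E × F | inner ℂ m p.2 = (0 : ℂ)} :=
      isClosed_eq (by fun_prop) continuous_const
    refine closure_minimal ?_ hcl hp
    rintro ⟨a, b⟩ ⟨_, hb⟩
    obtain ⟨c, hc⟩ := mem_dom.1 hb
    simpa using inner_eq_of_mem_adjoint hm hc
  have hmem : (x, y) ∈ D.topologicalClosure := by
    obtain ⟨p, p', q, q', hp, rfl, rfl, hq⟩ := exists_orthogonal_decomposition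
      D.isClosed_topologicalClosure x y
    have hqT : (q, q') ∈ opPart T := by simpa using sub_mem h (hDT hp)
    -- For `a + a' = q` with `(a, a') ∈ T* T`, orthogonality to `(a, φ) ∈ D` becomes `⟪a + a', q⟫ =
    -- 0`.
    have hq0 : q = 0 := by
      obtain ⟨a, φ, a', h1, h2, h3⟩ := exists_add_eq_of_isClosed hT q
      have h4 := hq a φ (D.le_topologicalClosure ⟨h1, mem_dom.2 ⟨a', h2⟩⟩)
      have h5 := inner_eq_of_mem_adjoint (mem_opPart.1 hqT).1 h2
      rw [← inner_conj_symm φ, h5, inner_conj_symm, ← inner_add_left, h3] at h4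
      exact inner_self_eq_zero.1 h4
    subst hq0
    have := opPart_unique hqT (zero_mem (opPart T))
    subst this
    simpa using hp
  obtain ⟨s, hs, hlim⟩ := mem_closure_iff_seq_limit.1 hmem
  choose w hw using fun n => mem_dom.1 (hs n).2
  exact ⟨fun n => (s n).1, fun n => (s n).2, w, fun n => (hs n).1, hw,
    (continuous_fst.tendsto _).comp hlim, (continuous_snd.tendsto _).comp hlim⟩

/-- Closed relations with the same `T* T` have operator parts with the same domain and norms. -/
theorem exists_mem_opPart_of_prod_adjoint_eq {G : Type*} [NormedAddCommGroup G]
    [InnerProductSpace ℂ G] [CompleteSpace E] [CompleteSpace F] [CompleteSpace G]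
    {S : LinRel E F} {T : LinRel E G} (hS : IsClosed (S : Set (E × F)))
    (hT : IsClosed (T : Set (E × G))) (hST : prod S.adjoint S = prod T.adjoint T)
    {x : E} {y : F} (h : (x, y) ∈ opPart S) : ∃ z, (x, z) ∈ opPart T ∧ ‖z‖ = ‖y‖ := by
  obtain ⟨u, v, w, huv, hvw, hu, hv⟩ := exists_seq_tendsto_of_mem_opPart hS h
  have hmem : ∀ n, (u n, w n) ∈ prod T.adjoint T := fun n => hST ▸ ⟨v n, huv n, hvw n⟩
  choose t ht htw using hmem
  -- The pair `(h, h')` alone determines `‖φ‖² = ⟪h, h'⟫`, whichever relation supplies the middle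
  -- vector `φ`.
  have hnorm : ∀ n m, ‖t n - t m‖ = ‖v n - v m‖ := fun n m => by
    have h1 := inner_of_mem_prod_adjoint (sub_mem (ht n) (ht m)) (sub_mem (htw n) (htw m))
    have h2 := inner_of_mem_prod_adjoint (sub_mem (huv n) (huv m)) (sub_mem (hvw n) (hvw m))
    exact (sq_eq_sq₀ (norm_nonneg _) (norm_nonneg _)).1 (Complex.ofReal_injective (h1.symm.trans h2))
  have hnorm' : ∀ n, ‖t n‖ = ‖v n‖ := fun n => by
    have h1 := inner_of_mem_prod_adjoint (ht n) (htw n)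
    have h2 := inner_of_mem_prod_adjoint (huv n) (hvw n)
    exact (sq_eq_sq₀ (norm_nonneg _) (norm_nonneg _)).1 (Complex.ofReal_injective (h1.symm.trans h2))
  have hc : CauchySeq t := by
    have := hv.cauchySeq
    rw [Metric.cauchySeq_iff] at this ⊢
    simpa only [dist_eq_norm, hnorm] using this
  obtain ⟨z, hz⟩ := cauchySeq_tendsto_of_complete hc
  refine ⟨z, mem_opPart.2 ⟨?_, fun m hm => ?_⟩, ?_⟩
  · exact hT.mem_of_tendsto (hu.prodMk_nhds hz) (Filter.Eventually.of_forall ht)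
  · refine tendsto_nhds_unique (tendsto_const_nhds.inner hz) ?_
    have : ∀ n, inner ℂ m (t n) = (0 : ℂ) := fun n => by
      simpa using inner_eq_of_mem_adjoint hm (htw n)
    simp only [this, tendsto_const_nhds]
  · refine tendsto_nhds_unique hz.norm ?_
    simpa only [hnorm'] using hv.norm

end Adjoint

/-! ### Square roots of nonnegative selfadjoint relations. -/

section Sqrt

open scoped ComplexOrder

/-- A relation that is bounded by `c` is contained in the graph of a bounded operator. -/
theorem exists_clm_of_norm_le {X Y : Type*} [NormedAddCommGroup X] [InnerProductSpace ℂ X]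
    [CompleteSpace X] [NormedAddCommGroup Y] [InnerProductSpace ℂ Y] [CompleteSpace Y]
    (L : LinRel X Y) {c : ℝ} (hc : 0 ≤ c) (hL : ∀ x y, (x, y) ∈ L → ‖y‖ ≤ c * ‖x‖) :
    ∃ V : X →L[ℂ] Y, ‖V‖ ≤ c ∧ ∀ x y, (x, y) ∈ L → V x = y := by
  let M : Submodule ℂ X := (dom L).topologicalClosure
  have : CompleteSpace M := (dom L).isClosed_topologicalClosure.completeSpace_coe
  have hmem : ∀ p : L, p.1.1 ∈ dom L := fun p => mem_dom.2 ⟨p.1.2, p.2⟩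
  let e : L →ₗ[ℂ] M := ((LinearMap.fst ℂ X Y).comp L.subtype).codRestrict M
    fun p => (dom L).le_topologicalClosure (hmem p)
  let f : L →ₗ[ℂ] Y := (LinearMap.snd ℂ X Y).comp L.subtype
  have he : DenseRange e := by
    intro x
    rw [Topology.IsInducing.subtypeVal.closure_eq_preimage_closure_image]
    refine closure_mono ?_ x.2
    intro a ha
    obtain ⟨b, hb⟩ := mem_dom.1 ha
    exact ⟨e ⟨(a, b), hb⟩, ⟨_, rfl⟩, rfl⟩
  have hn : ∀ p, ‖f p‖ ≤ c * ‖e p‖ := fun p => hL _ _ p.2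
  -- Extension by continuity to the closed domain, and by zero on its orthogonal complement.
  refine ⟨(f.extendOfNorm e).comp M.orthogonalProjectionOnto, ?_, ?_⟩
  · refine ContinuousLinearMap.opNorm_le_bound _ hc fun x => ?_
    refine (LinearMap.norm_extendOfNorm_apply_le he c hn _).trans ?_
    exact mul_le_mul_of_nonneg_left (M.norm_orthogonalProjectionOnto_apply_le x) hc
  · intro x y hxy
    have hx : M.orthogonalProjectionOnto x = e ⟨(x, y), hxy⟩ :=
      M.orthogonalProjectionOnto_mem_subspace_eq_self (e ⟨(x, y), hxy⟩)
    rw [ContinuousLinearMap.comp_apply, hx, LinearMap.extendOfNorm_eq he ⟨c, hn⟩]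
    rfl

variable {H : Type*} [NormedAddCommGroup H] [InnerProductSpace ℂ H] [CompleteSpace H]

/-- `C = P ^ 2` and `1 - C = Q ^ 2` with commuting nonnegative `P`, `Q`, when `0 ≤ C ≤ 1`. -/
theorem exists_sqrt_pair {C : H →L[ℂ] H} (h0 : 0 ≤ C) (h1 : C ≤ 1) :
    ∃ P Q : H →L[ℂ] H, IsSelfAdjoint P ∧ IsSelfAdjoint Q ∧ P * P = C ∧ Q * Q = 1 - C ∧
      P * Q = Q * P ∧ 0 ≤ P * Q := by
  have hsa : IsSelfAdjoint C := IsSelfAdjoint.of_nonneg h0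
  have hs0 : ∀ x ∈ spectrum ℝ C, 0 ≤ x := fun x hx => spectrum_nonneg_of_nonneg h0 hx
  have hs1 : ∀ x ∈ spectrum ℝ C, x ≤ 1 := by
    have := (CFC.le_one_iff (R := ℝ) C hsa).1 h1
    exact this
  refine ⟨cfc (fun x : ℝ => √x) C, cfc (fun x : ℝ => √(1 - x)) C, cfc_predicate _ _,
    cfc_predicate _ _, ?_, ?_, cfc_commute_cfc _ _ _, ?_⟩
  · rw [← cfc_mul (fun x : ℝ => √x) (fun x : ℝ => √x) C (by fun_prop) (by fun_prop)]
    conv_rhs => rw [← cfc_id ℝ C]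
    exact cfc_congr fun x hx => Real.mul_self_sqrt (hs0 x hx)
  · rw [← cfc_mul (fun x : ℝ => √(1 - x)) (fun x : ℝ => √(1 - x)) C (by fun_prop) (by fun_prop)]
    have h : cfc (fun x : ℝ => 1 - x) C = 1 - C := by
      rw [cfc_sub (fun _ : ℝ => 1) (fun x : ℝ => x) C, cfc_const_one ℝ C, cfc_id' ℝ C]
    rw [← h]
    exact cfc_congr fun x hx => Real.mul_self_sqrt (sub_nonneg.2 (hs1 x hx))
  · rw [← cfc_mul (fun x : ℝ => √x) (fun x : ℝ => √(1 - x)) C (by fun_prop) (by fun_prop)]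
    exact cfc_nonneg fun x _ => by positivity

theorem IsNonnegSelfAdjoint.inner_nonneg {H : Type*} [NormedAddCommGroup H]
    [InnerProductSpace ℂ H] {R : LinRel H H} (hR : IsNonnegSelfAdjoint R) {f f' : H}
    (h : (f, f') ∈ R) : 0 ≤ inner ℂ f f' :=
  Complex.le_def.2 ⟨(hR.nonneg f f' h).1, (hR.nonneg f f' h).2.symm⟩

/-- The relation `{(P u, Q u)}` is nonnegative selfadjoint. -/
theorem isNonnegSelfAdjoint_range {P Q : H →L[ℂ] H} (hP : IsSelfAdjoint P) (hQ : IsSelfAdjoint Q)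
    (hPQ : P * P + Q * Q = 1) (hcomm : P * Q = Q * P) (hpos : 0 ≤ P * Q) :
    IsNonnegSelfAdjoint (LinearMap.range ((P : H →ₗ[ℂ] H).prod (Q : H →ₗ[ℂ] H))) := by
  have hP' : ∀ x y, inner ℂ (P x) y = inner ℂ x (P y) := hP.isSymmetric
  have hQ' : ∀ x y, inner ℂ (Q x) y = inner ℂ x (Q y) := hQ.isSymmetric
  have e1 : ∀ x, P (P x) + Q (Q x) = x := fun x => congrArg (fun T : H →L[ℂ] H => T x) hPQ
  have e2 : ∀ x, P (Q x) = Q (P x) := fun x => congrArg (fun T : H →L[ℂ] H => T x) hcomm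
  refine ⟨?_, ?_⟩
  · ext ⟨g, g'⟩
    constructor
    · intro h
      have h1 : Q g = P g' := by
        refine ext_inner_left ℂ fun u => ?_
        have := mem_adjoint.1 h (P u) (Q u) ⟨u, rfl⟩
        rwa [hQ' u g, hP' u g'] at this
      -- If `(g, g') = (P u, Q u)`, then `P² + Q² = 1` forces this `u`.
      refine ⟨P g + Q g', ?_⟩
      refine Prod.ext ?_ ?_
      · change P (P g + Q g') = g
        rw [map_add, e2, ← h1, e1]
      · change Q (P g + Q g') = g'
        rw [map_add, ← e2, h1, e1]
    · rintro ⟨u, hu⟩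
      obtain ⟨rfl, rfl⟩ := Prod.ext_iff.1 hu
      refine mem_adjoint.2 ?_
      rintro f f' ⟨v, hv⟩
      obtain ⟨rfl, rfl⟩ := Prod.ext_iff.1 hv
      change inner ℂ (Q v) (P u) = inner ℂ (P v) (Q u)
      rw [hQ' v, hP' v, e2]
  · rintro f f' ⟨u, hu⟩
    obtain ⟨rfl, rfl⟩ := Prod.ext_iff.1 hu
    have h := ((ContinuousLinearMap.nonneg_iff_isPositive _).1 hpos).inner_nonneg_right u
    change 0 ≤ (inner ℂ (P u) (Q u)).re ∧ (inner ℂ (P u) (Q u)).im = 0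
    rw [hP' u (Q u)]
    exact ⟨(Complex.le_def.1 h).1, (Complex.le_def.1 h).2.symm⟩

/-- With `C = (1 + R)⁻¹` one has `0 ≤ C ≤ 1` and `R = {(C u, (1 - C) u)}`; the root is `{(C^{1/2} u,
(1 - C)^{1/2} u)}`. The multivalued part is the kernel of `C` and needs no separate treatment. -/
theorem exists_isSqrt {R : LinRel H H} (hR : IsNonnegSelfAdjoint R)
    (hran : ∀ u, ∃ h h', (h, h') ∈ R ∧ h + h' = u) : ∃ K, IsSqrt K R := by
  let L : LinRel H H :=
    R.map ((LinearMap.fst ℂ H H + LinearMap.snd ℂ H H).prod (LinearMap.fst ℂ H H))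
  have hL : ∀ x y, (x, y) ∈ L → ‖y‖ ≤ 1 * ‖x‖ := by
    rintro x y ⟨⟨h, h'⟩, hh, hxy⟩
    obtain ⟨rfl, rfl⟩ := Prod.ext_iff.1 hxy
    change ‖h‖ ≤ 1 * ‖h + h'‖
    rw [one_mul]
    have h1 := (hR.nonneg h h' hh).1
    have h2 := norm_add_sq (𝕜 := ℂ) h h'
    change _ = _ + 2 * (inner ℂ h h').re + _ at h2
    nlinarith [norm_nonneg h, norm_nonneg (h + h'), sq_nonneg ‖h'‖]
  obtain ⟨C, -, hC⟩ := exists_clm_of_norm_le L zero_le_one hL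
  have hC' : ∀ h h', (h, h') ∈ R → C (h + h') = h := fun h h' hh => hC _ _ ⟨(h, h'), hh, rfl⟩
  have hmem : ∀ u, (C u, u - C u) ∈ R := fun u => by
    obtain ⟨h, h', hh, rfl⟩ := hran u
    rw [hC' h h' hh, add_sub_cancel_left]; exact hh
  have hpos : ∀ u, 0 ≤ inner ℂ (C u) (u - C u) := fun u => hR.inner_nonneg (hmem u)
  have hself : ∀ x : H, 0 ≤ inner ℂ x x := fun x =>
    (ContinuousLinearMap.isPositive_one (𝕜 := ℂ) (E := H)).inner_nonneg_left x
  have h0 : 0 ≤ C := by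
    rw [ContinuousLinearMap.nonneg_iff_isPositive, ContinuousLinearMap.isPositive_iff_complex]
    intro u
    have : 0 ≤ inner ℂ (C u) u := by
      have := add_nonneg (hpos u) (hself (C u))
      rwa [← inner_add_right, sub_add_cancel] at this
    exact ⟨Complex.ext rfl (Complex.le_def.1 this).2, (Complex.le_def.1 this).1⟩
  have h1 : C ≤ 1 := by
    rw [ContinuousLinearMap.le_def, ContinuousLinearMap.isPositive_iff_complex]
    intro u
    have : 0 ≤ inner ℂ (u - C u) u := by
      have h2 : 0 ≤ inner ℂ (u - C u) (C u) := by
        rw [← inner_conj_symm]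
        exact star_nonneg_iff.2 (hpos u)
      have := add_nonneg h2 (hself (u - C u))
      rwa [← inner_add_right, add_sub_cancel] at this
    exact ⟨Complex.ext rfl (Complex.le_def.1 this).2, (Complex.le_def.1 this).1⟩
  obtain ⟨P, Q, hP, hQ, hPP, hQQ, hcomm, hnn⟩ := exists_sqrt_pair h0 h1
  have hPQ : P * P + Q * Q = 1 := by rw [hPP, hQQ, add_sub_cancel]
  have e1 : ∀ x, P (P x) + Q (Q x) = x := fun x => congrArg (fun T : H →L[ℂ] H => T x) hPQ
  have e2 : ∀ x, P (Q x) = Q (P x) := fun x => congrArg (fun T : H →L[ℂ] H => T x) hcomm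
  have e3 : ∀ x, P (P x) = C x := fun x => congrArg (fun T : H →L[ℂ] H => T x) hPP
  have e4 : ∀ x, Q (Q x) = x - C x := fun x => congrArg (fun T : H →L[ℂ] H => T x) hQQ
  refine ⟨_, isNonnegSelfAdjoint_range hP hQ hPQ hcomm hnn, ?_⟩
  ext ⟨x, y⟩
  constructor
  · rintro ⟨φ, ⟨u, hu⟩, ⟨v, hv⟩⟩
    obtain ⟨rfl, rfl⟩ := Prod.ext_iff.1 hu
    obtain ⟨huv, rfl⟩ := Prod.ext_iff.1 hv
    change P v = Q u at huv
    change (P u, Q v) ∈ R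
    -- The vector `w = P u + Q v` has `P w = u` and `Q w = v`, so `(P u, Q v) = (C w, w - C w)`.
    have h3 : P (P u + Q v) = u := by rw [map_add, e2, huv, e1]
    have h4 : Q (P u + Q v) = v := by rw [map_add, ← e2, ← huv, e1]
    have := hmem (P u + Q v)
    rwa [← e4, ← e3, h3, h4] at this
  · intro hxy
    have hx := hC' x y hxy
    refine ⟨Q (P (x + y)), ⟨P (x + y), ?_⟩, ⟨Q (x + y), ?_⟩⟩
    · exact Prod.ext ((e3 _).trans hx) rfl
    · refine Prod.ext (e2 _) ((e4 _).trans ?_)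
      rw [hx]; exact add_sub_cancel_left x y

end Sqrt

/-! ### Douglas factorization and the constant `c`. -/

section Douglas

variable {HA HB H : Type*}
  [NormedAddCommGroup HA] [InnerProductSpace ℂ HA] [CompleteSpace HA]
  [NormedAddCommGroup HB] [InnerProductSpace ℂ HB] [CompleteSpace HB]
  [NormedAddCommGroup H] [InnerProductSpace ℂ H] [CompleteSpace H]

theorem mem_ofOp {E F : Type*} [NormedAddCommGroup E] [InnerProductSpace ℂ E]
    [NormedAddCommGroup F] [InnerProductSpace ℂ F] {W : E →L[ℂ] F} {x : E} {y : F} :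
    (x, y) ∈ ofOp W ↔ y = W x := by
  simp [ofOp]

theorem le_prod_ofOp_iff {E F G : Type*} [NormedAddCommGroup E] [InnerProductSpace ℂ E]
    [NormedAddCommGroup F] [InnerProductSpace ℂ F] [NormedAddCommGroup G] [InnerProductSpace ℂ G]
    {A : LinRel E G} {B : LinRel F G} {W : E →L[ℂ] F} :
    A ≤ prod B (ofOp W) ↔ ∀ f f', (f, f') ∈ A → (W f, f') ∈ B := by
  constructor
  · intro h f f' hf
    obtain ⟨φ, h1, h2⟩ := h hf
    rwa [← mem_ofOp.1 h1]
  · rintro h ⟨f, f'⟩ hf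
    exact ⟨W f, mem_ofOp.2 rfl, h f f' hf⟩

theorem mem_ofOpOn {E F : Type*} [NormedAddCommGroup E] [InnerProductSpace ℂ E]
    [NormedAddCommGroup F] [InnerProductSpace ℂ F] {M : Submodule ℂ E} {N : Submodule ℂ F}
    {W : M →L[ℂ] N} {x : E} {y : F} :
    (x, y) ∈ ofOpOn W ↔ ∃ m : M, (m : E) = x ∧ (W m : F) = y := by
  simp [ofOpOn]

/-- A square root of `A A*` has the operator part of `A*`, up to an isometry. -/
theorem exists_mem_opPart_adjoint_of_isSqrt {A : LinRel HA H} (hA : IsClosed (A : Set (HA × H)))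
    {K : LinRel H H} (hK : IsSqrt K (prod A A.adjoint)) :
    (∀ h k, (h, k) ∈ opPart K → ∃ a, (h, a) ∈ opPart A.adjoint ∧ ‖a‖ = ‖k‖) ∧
      ∀ h a, (h, a) ∈ opPart A.adjoint → ∃ k, (h, k) ∈ opPart K ∧ ‖k‖ = ‖a‖ := by
  have hKc : IsClosed (K : Set (H × H)) := hK.nonnegSelfAdjoint.selfAdjoint ▸ isClosed_adjoint K
  have heq : prod K.adjoint K = prod A.adjoint.adjoint A.adjoint := by
    rw [hK.nonnegSelfAdjoint.selfAdjoint, adjoint_adjoint hA, hK.sq]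
  exact ⟨fun h k hk => exists_mem_opPart_of_prod_adjoint_eq hKc (isClosed_adjoint A) heq hk,
    fun h a ha => exists_mem_opPart_of_prod_adjoint_eq (isClosed_adjoint A) hKc heq.symm ha⟩

theorem isNonnegSelfAdjoint_prod_adjoint' {A : LinRel HA H} (hA : IsClosed (A : Set (HA × H))) :
    IsNonnegSelfAdjoint (prod A A.adjoint) := by
  have := isNonnegSelfAdjoint_prod_adjoint (isClosed_adjoint A)
  rwa [adjoint_adjoint hA] at this

theorem exists_isSqrt_prod_adjoint {A : LinRel HA H} (hA : IsClosed (A : Set (HA × H))) :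
    ∃ K, IsSqrt K (prod A A.adjoint) := by
  refine exists_isSqrt (isNonnegSelfAdjoint_prod_adjoint' hA) fun u => ?_
  obtain ⟨h, φ, h', h1, h2, h3⟩ := exists_add_eq_of_isClosed (isClosed_adjoint A) u
  rw [adjoint_adjoint hA] at h2
  exact ⟨h, h', ⟨φ, h1, h2⟩, h3⟩

/-- Removes the square roots from the order. Any `b` with `(h, b) ∈ B*` is allowed, since the
operator part has the least norm among the values at `h`. -/
theorem formLE_prod_adjoint_iff {A : LinRel HA H} {B : LinRel HB H}
    (hA : IsClosed (A : Set (HA × H))) (hB : IsClosed (B : Set (HB × H))) :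
    FormLE (prod A A.adjoint) (prod B B.adjoint) ↔
      ∀ h b, (h, b) ∈ B.adjoint → ∃ a, (h, a) ∈ opPart A.adjoint ∧ ‖a‖ ≤ ‖b‖ := by
  constructor
  · rintro ⟨-, -, K₁, K₂, hK₁, hK₂, hdom, hle⟩ h b hb
    obtain ⟨b', hb', hbb⟩ := exists_mem_opPart (isClosed_adjoint B) hb
    obtain ⟨k₂, hk₂, hkb⟩ := (exists_mem_opPart_adjoint_of_isSqrt hB hK₂).2 h b' hb'
    obtain ⟨k₁, hk₁⟩ := mem_dom.1 (hdom (mem_dom.2 ⟨k₂, hk₂⟩))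
    obtain ⟨a, ha, hak⟩ := (exists_mem_opPart_adjoint_of_isSqrt hA hK₁).1 h k₁ hk₁
    exact ⟨a, ha, hak.trans_le ((hle h k₁ k₂ hk₁ hk₂).trans (hkb.trans_le hbb))⟩
  · intro hAB
    obtain ⟨K₁, hK₁⟩ := exists_isSqrt_prod_adjoint hA
    obtain ⟨K₂, hK₂⟩ := exists_isSqrt_prod_adjoint hB
    have key : ∀ h k₂, (h, k₂) ∈ opPart K₂ → ∃ k₁, (h, k₁) ∈ opPart K₁ ∧ ‖k₁‖ ≤ ‖k₂‖ := by
      intro h k₂ hk₂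
      obtain ⟨b, hb, hbk⟩ := (exists_mem_opPart_adjoint_of_isSqrt hB hK₂).1 h k₂ hk₂
      obtain ⟨a, ha, hab⟩ := hAB h b (mem_opPart.1 hb).1
      obtain ⟨k₁, hk₁, hka⟩ := (exists_mem_opPart_adjoint_of_isSqrt hA hK₁).2 h a ha
      exact ⟨k₁, hk₁, hka.trans_le (hab.trans_eq hbk)⟩
    refine ⟨isNonnegSelfAdjoint_prod_adjoint' hA, isNonnegSelfAdjoint_prod_adjoint' hB, K₁, K₂,
      hK₁, hK₂, fun h hh => ?_, fun h k₁ k₂ h1 h2 => ?_⟩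
    · obtain ⟨k₂, hk₂⟩ := mem_dom.1 hh
      obtain ⟨k₁, hk₁, -⟩ := key h k₂ hk₂
      exact mem_dom.2 ⟨k₁, hk₁⟩
    · obtain ⟨k, hk, hle⟩ := key h k₂ h2
      rwa [opPart_unique h1 hk]

/-- Douglas' lemma for relations, contractive case. -/
theorem exists_contraction_iff_formLE {A : LinRel HA H} {B : LinRel HB H}
    (hA : IsClosed (A : Set (HA × H))) (hB : IsClosed (B : Set (HB × H))) :
    (∃ W : HA →L[ℂ] HB, ‖W‖ ≤ 1 ∧ A ≤ prod B (ofOp W)) ↔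
      FormLE (prod A A.adjoint) (prod B B.adjoint) := by
  rw [formLE_prod_adjoint_iff hA hB]
  constructor
  · rintro ⟨W, hW, hAB⟩ h b hb
    have hmem : (h, W.adjoint b) ∈ A.adjoint := mem_adjoint.2 fun f f' hf => by
      rw [ContinuousLinearMap.adjoint_inner_right]
      exact inner_eq_of_mem_adjoint (le_prod_ofOp_iff.1 hAB f f' hf) hb
    obtain ⟨a, ha, hle⟩ := exists_mem_opPart (isClosed_adjoint A) hmem
    refine ⟨a, ha, hle.trans ((W.adjoint.le_opNorm b).trans ?_)⟩
    rw [LinearIsometryEquiv.norm_map]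
    exact mul_le_of_le_one_left (norm_nonneg b) hW
  · intro hAB
    -- The correspondence `b ↦ a` over a common `h`; the hypothesis makes it contractive, hence
    -- single-valued.
    let L : LinRel HB HA :=
      { carrier := {p | ∃ h, (h, p.1) ∈ B.adjoint ∧ (h, p.2) ∈ opPart A.adjoint}
        zero_mem' := ⟨0, zero_mem _, zero_mem _⟩
        add_mem' := by
          rintro p q ⟨h, h1, h2⟩ ⟨g, h3, h4⟩
          exact ⟨h + g, add_mem h1 h3, add_mem h2 h4⟩
        smul_mem' := by
          rintro c p ⟨h, h1, h2⟩
          exact ⟨c • h, Submodule.smul_mem _ c h1, Submodule.smul_mem _ c h2⟩ }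
    obtain ⟨V, hV, hVL⟩ := exists_clm_of_norm_le L zero_le_one (by
      rintro b a ⟨h, hb, ha⟩
      obtain ⟨a', ha', hle⟩ := hAB h b hb
      rw [one_mul]
      obtain rfl : a = a' := opPart_unique ha ha'
      exact hle)
    refine ⟨V.adjoint, by rwa [LinearIsometryEquiv.norm_map], le_prod_ofOp_iff.2 ?_⟩
    intro f f' hf
    rw [← adjoint_adjoint hB]
    refine mem_adjoint.2 fun h b hb => ?_
    obtain ⟨a, ha, -⟩ := hAB h b hb
    rw [ContinuousLinearMap.adjoint_inner_right, hVL b a ⟨h, hb, ha⟩, ← inner_conj_symm,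
      ← inner_conj_symm h, inner_eq_of_mem_adjoint hf (mem_opPart.1 ha).1]

theorem smul_mem_scale_iff {E F : Type*} [NormedAddCommGroup E] [InnerProductSpace ℂ E]
    [NormedAddCommGroup F] [InnerProductSpace ℂ F] {T : LinRel E F} {c : ℝ} (hc : c ≠ 0)
    {x : E} {y : F} : (x, (c : ℂ) • y) ∈ scale c T ↔ (x, y) ∈ T := by
  have hc' : (c : ℂ) ≠ 0 := by exact_mod_cast hc
  rw [mem_scale]
  constructor
  · rintro ⟨z, hz, h⟩
    rwa [smul_right_injective F hc' h]
  · exact fun h => ⟨y, h, rfl⟩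

theorem isClosed_scale {E F : Type*} [NormedAddCommGroup E] [InnerProductSpace ℂ E]
    [NormedAddCommGroup F] [InnerProductSpace ℂ F] {T : LinRel E F} {c : ℝ} (hc : c ≠ 0)
    (hT : IsClosed (T : Set (E × F))) : IsClosed (scale c T : Set (E × F)) := by
  have hc' : (c : ℂ) ≠ 0 := by exact_mod_cast hc
  have : (scale c T : Set (E × F)) = (fun p => (p.1, (c : ℂ)⁻¹ • p.2)) ⁻¹' (T : Set (E × F)) := by
    ext ⟨x, y⟩
    change (x, y) ∈ scale c T ↔ (x, (c : ℂ)⁻¹ • y) ∈ T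
    rw [← smul_mem_scale_iff (T := T) hc, smul_inv_smul₀ hc']
  rw [this]
  exact hT.preimage (by fun_prop)

theorem mem_adjoint_scale {E F : Type*} [NormedAddCommGroup E] [InnerProductSpace ℂ E]
    [NormedAddCommGroup F] [InnerProductSpace ℂ F] {T : LinRel E F} {c : ℝ} {g : F} {g' : E} :
    (g, g') ∈ (scale c T).adjoint ↔ ((c : ℂ) • g, g') ∈ T.adjoint := by
  have hcomm : ∀ f' : F, inner ℂ ((c : ℂ) • f') g = inner ℂ f' ((c : ℂ) • g) := fun f' => by
    rw [inner_smul_left, inner_smul_right, Complex.conj_ofReal]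
  rw [mem_adjoint, mem_adjoint]
  constructor
  · intro h f f' hf
    rw [← hcomm]
    exact h _ _ (mem_scale.2 ⟨f', hf, rfl⟩)
  · intro h f f' hf
    obtain ⟨z, hz, rfl⟩ := mem_scale.1 hf
    rw [hcomm, h _ _ hz]

/-- `(c B) (c B)* = c² B B*` for `c ≠ 0`. -/
theorem prod_scale_adjoint {E F : Type*} [NormedAddCommGroup E] [InnerProductSpace ℂ E]
    [NormedAddCommGroup F] [InnerProductSpace ℂ F] (T : LinRel E F) {c : ℝ} (hc : c ≠ 0) :
    prod (scale c T) (scale c T).adjoint = scale (c ^ 2) (prod T T.adjoint) := by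
  have hc' : (c : ℂ) ≠ 0 := by exact_mod_cast hc
  ext ⟨x, y⟩
  rw [mem_prod, mem_scale]
  constructor
  · rintro ⟨φ, h1, h2⟩
    obtain ⟨z, hz, rfl⟩ := mem_scale.1 h2
    have h3 := Submodule.smul_mem _ (c : ℂ)⁻¹ (mem_adjoint_scale.1 h1)
    have h4 := Submodule.smul_mem _ (c : ℂ)⁻¹ hz
    rw [Prod.smul_mk, inv_smul_smul₀ hc'] at h3
    refine ⟨(c : ℂ)⁻¹ • z, ⟨_, h3, h4⟩, ?_⟩
    rw [Complex.ofReal_pow, pow_two, mul_smul, smul_inv_smul₀ hc']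
  · rintro ⟨z, ⟨φ, h1, h2⟩, rfl⟩
    refine ⟨(c : ℂ) • φ, mem_adjoint_scale.2 (Submodule.smul_mem _ (c : ℂ) h1), ?_⟩
    rw [Complex.ofReal_pow, pow_two, mul_smul, smul_mem_scale_iff hc]
    exact Submodule.smul_mem _ (c : ℂ) h2

/-- The contractive case for `c B`, with factors `W` and `c⁻¹ W` corresponding. -/
theorem exists_norm_le_iff_formLE {A : LinRel HA H} {B : LinRel HB H}
    (hA : IsClosed (A : Set (HA × H))) (hB : IsClosed (B : Set (HB × H))) {c : ℝ} (hc : 0 < c) :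
    (∃ W : HA →L[ℂ] HB, ‖W‖ ≤ c ∧ A ≤ prod B (ofOp W)) ↔
      FormLE (prod A A.adjoint) (scale (c ^ 2) (prod B B.adjoint)) := by
  have hc' : (c : ℂ) ≠ 0 := by exact_mod_cast hc.ne'
  have hn : ‖(c : ℂ)‖ = c := by rw [Complex.norm_real, Real.norm_of_nonneg hc.le]
  rw [← prod_scale_adjoint B hc.ne', ← exists_contraction_iff_formLE hA (isClosed_scale hc.ne' hB)]
  simp only [le_prod_ofOp_iff]
  constructor
  · rintro ⟨W, hW, h⟩
    refine ⟨(c : ℂ)⁻¹ • W, ?_, fun f f' hf => ?_⟩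
    · rw [norm_smul, norm_inv, hn, inv_mul_le_iff₀ hc, mul_one]; exact hW
    · have := Submodule.smul_mem _ (c : ℂ)⁻¹ (h f f' hf)
      refine mem_scale.2 ⟨(c : ℂ)⁻¹ • f', this, ?_⟩
      rw [smul_inv_smul₀ hc']
  · rintro ⟨W, hW, h⟩
    refine ⟨(c : ℂ) • W, ?_, fun f f' hf => ?_⟩
    · rw [norm_smul, hn]; exact mul_le_of_le_one_right hc.le hW
    · obtain ⟨z, hz, rfl⟩ := mem_scale.1 (h f f' hf)
      exact Submodule.smul_mem _ (c : ℂ) hz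

/-- Selfadjointness of `0 • R` forces it to be the zero operator on the whole space. -/
theorem scale_zero_eq_of_selfAdjoint {H : Type*} [NormedAddCommGroup H]
    [InnerProductSpace ℂ H] {R : LinRel H H}
    (h : (scale 0 R).adjoint = scale 0 R) : scale 0 R = (⊤ : Submodule ℂ H).prod ⊥ := by
  have h0 : ∀ x y, (x, y) ∈ scale 0 R → y = 0 := fun x y hxy => by
    obtain ⟨z, -, rfl⟩ := mem_scale.1 hxy
    simp
  ext ⟨x, y⟩
  refine ⟨fun hxy => ⟨trivial, h0 x y hxy⟩, fun hxy => ?_⟩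
  obtain rfl : y = 0 := hxy.2
  rw [← h]
  refine mem_adjoint.2 fun f f' hf => ?_
  rw [h0 f f' hf, inner_zero_left, inner_zero_right]

/-- The right side must be `Z = H × {0}`, and `Z = Z Z*`; the contractive case then gives `A ⊂ Z W`,
whose values all vanish. -/
theorem eq_zero_of_formLE_scale_zero {A : LinRel HA H} (hA : IsClosed (A : Set (HA × H)))
    {R : LinRel H H} (h : FormLE (prod A A.adjoint) (scale 0 R)) {f : HA} {f' : H}
    (hf : (f, f') ∈ A) : f' = 0 := by
  let Z : LinRel H H := (⊤ : Submodule ℂ H).prod ⊥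
  have hZ : IsClosed (Z : Set (H × H)) := by
    have : (Z : Set (H × H)) = Prod.snd ⁻¹' {0} := by ext; simp [Z]
    rw [this]
    exact isClosed_singleton.preimage continuous_snd
  have hR : scale 0 R = Z := scale_zero_eq_of_selfAdjoint h.2.1.selfAdjoint
  have hZa : Z.adjoint = Z := by rw [← hR]; exact h.2.1.selfAdjoint
  have hZZ : prod Z Z.adjoint = Z := by
    rw [hZa]
    ext ⟨x, y⟩
    exact ⟨fun ⟨φ, _, h2⟩ => ⟨trivial, h2.2⟩, fun hxy => ⟨0, ⟨trivial, rfl⟩, ⟨trivial, hxy.2⟩⟩⟩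
  rw [hR, ← hZZ] at h
  obtain ⟨W, -, hW⟩ := (exists_contraction_iff_formLE hA hZ).2 h
  exact (le_prod_ofOp_iff.1 hW f f' hf).2

theorem exists_norm_le_of_formLE {A : LinRel HA H} {B : LinRel HB H}
    (hA : IsClosed (A : Set (HA × H))) (hB : IsClosed (B : Set (HB × H))) {c : ℝ} (hc : 0 ≤ c)
    (h : FormLE (prod A A.adjoint) (scale (c ^ 2) (prod B B.adjoint))) :
    ∃ W : HA →L[ℂ] HB, ‖W‖ ≤ c ∧ A ≤ prod B (ofOp W) := by
  rcases hc.eq_or_lt with rfl | hc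
  · rw [zero_pow two_ne_zero] at h
    refine ⟨0, norm_zero.le, le_prod_ofOp_iff.2 fun f f' hf => ?_⟩
    rw [eq_zero_of_formLE_scale_zero hA h hf]
    exact zero_mem B
  · exact (exists_norm_le_iff_formLE hA hB hc).2 h

end Douglas

/-! ### Passage between the two classes of factors. -/

section Restriction

variable {E F G : Type*} [NormedAddCommGroup E] [InnerProductSpace ℂ E]
  [NormedAddCommGroup F] [InnerProductSpace ℂ F] [NormedAddCommGroup G] [InnerProductSpace ℂ G]

/-- A factor on the whole space restricts to the closures of the domains. -/
theorem exists_ofOpOn_of_ofOp {A : LinRel E G} {B : LinRel F G}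
    {W : E →L[ℂ] F} (h : A ≤ prod B (ofOp W)) :
    ∃ V : (dom A).topologicalClosure →L[ℂ] (dom B).topologicalClosure,
      ‖V‖ ≤ ‖W‖ ∧ A ≤ prod B (ofOpOn V) := by
  have hmap : ∀ x : (dom A).topologicalClosure, W x ∈ (dom B).topologicalClosure := by
    intro x
    refine map_mem_closure W.continuous x.2 fun f hf => ?_
    obtain ⟨f', hf'⟩ := mem_dom.1 hf
    exact mem_dom.2 ⟨f', le_prod_ofOp_iff.1 h f f' hf'⟩
  refine ⟨(W.comp (dom A).topologicalClosure.subtypeL).codRestrict _ hmap, ?_, ?_⟩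
  · exact ContinuousLinearMap.opNorm_le_bound _ (norm_nonneg W) fun x => W.le_opNorm x
  · rintro ⟨f, f'⟩ hf
    have hfd : f ∈ (dom A).topologicalClosure :=
      (dom A).le_topologicalClosure (mem_dom.2 ⟨f', hf⟩)
    exact ⟨W f, mem_ofOpOn.2 ⟨⟨f, hfd⟩, rfl, rfl⟩, le_prod_ofOp_iff.1 h f f' hf⟩

theorem exists_ofOp_of_ofOpOn [CompleteSpace E] {A : LinRel E G} {B : LinRel F G}
    {V : (dom A).topologicalClosure →L[ℂ] (dom B).topologicalClosure}
    (h : A ≤ prod B (ofOpOn V)) : ∃ W : E →L[ℂ] F, A ≤ prod B (ofOp W) := by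
  have : CompleteSpace (dom A).topologicalClosure :=
    (dom A).isClosed_topologicalClosure.completeSpace_coe
  -- `V` is extended by zero on the orthogonal complement of `dom A`.
  refine ⟨(dom B).topologicalClosure.subtypeL.comp
    (V.comp (dom A).topologicalClosure.orthogonalProjectionOnto), le_prod_ofOp_iff.2 ?_⟩
  intro f f' hf
  obtain ⟨φ, h1, h2⟩ := h hf
  obtain ⟨m, rfl, rfl⟩ := mem_ofOpOn.1 h1
  simpa using h2

end Restriction

end LinRel

theorem theorem3p4 {HA HB H : Type*}
    [NormedAddCommGroup HA] [InnerProductSpace ℂ HA] [CompleteSpace HA]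
    [NormedAddCommGroup HB] [InnerProductSpace ℂ HB] [CompleteSpace HB]
    [NormedAddCommGroup H] [InnerProductSpace ℂ H] [CompleteSpace H]
    (A : LinRel HA H) (B : LinRel HB H)
    (hA : IsClosed (A : Set (HA × H))) (hB : IsClosed (B : Set (HB × H))) :
    ((∃ W : HA →L[ℂ] HB, A ≤ LinRel.prod B (LinRel.ofOp W)) ↔
      ∃ c : ℝ, 0 ≤ c ∧
        LinRel.FormLE (LinRel.prod A A.adjoint) (LinRel.scale (c ^ 2) (LinRel.prod B B.adjoint))) ∧
    ((∃ W : HA →L[ℂ] HB, A ≤ LinRel.prod B (LinRel.ofOp W)) ↔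
      ∃ W : (LinRel.dom A).topologicalClosure →L[ℂ] (LinRel.dom B).topologicalClosure,
        A ≤ LinRel.prod B (LinRel.ofOpOn W)) ∧
    (∀ c : ℝ, 0 ≤ c →
      LinRel.FormLE (LinRel.prod A A.adjoint) (LinRel.scale (c ^ 2) (LinRel.prod B B.adjoint)) →
      (∃ W : HA →L[ℂ] HB, ‖W‖ ≤ c ∧ A ≤ LinRel.prod B (LinRel.ofOp W)) ∧
      ∃ W : (LinRel.dom A).topologicalClosure →L[ℂ] (LinRel.dom B).topologicalClosure,
        ‖W‖ ≤ c ∧ A ≤ LinRel.prod B (LinRel.ofOpOn W)) := by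
  have hfwd : (∃ W : HA →L[ℂ] HB, A ≤ LinRel.prod B (LinRel.ofOp W)) → ∃ c : ℝ, 0 ≤ c ∧
      LinRel.FormLE (LinRel.prod A A.adjoint)
        (LinRel.scale (c ^ 2) (LinRel.prod B B.adjoint)) := by
    rintro ⟨W, hW⟩
    -- The `+ 1` keeps the constant positive when `W = 0`.
    have hc : 0 < ‖W‖ + 1 := by positivity
    exact ⟨‖W‖ + 1, hc.le, (LinRel.exists_norm_le_iff_formLE hA hB hc).1
      ⟨W, le_add_of_nonneg_right zero_le_one, hW⟩⟩
  refine ⟨⟨hfwd, ?_⟩, ⟨?_, ?_⟩, fun c hc h => ?_⟩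
  · rintro ⟨c, hc, h⟩
    obtain ⟨W, -, hW⟩ := LinRel.exists_norm_le_of_formLE hA hB hc h
    exact ⟨W, hW⟩
  · rintro ⟨W, hW⟩
    obtain ⟨V, -, hV⟩ := LinRel.exists_ofOpOn_of_ofOp hW
    exact ⟨V, hV⟩
  · rintro ⟨V, hV⟩
    exact LinRel.exists_ofOp_of_ofOpOn hV
  · obtain ⟨W, hWc, hW⟩ := LinRel.exists_norm_le_of_formLE hA hB hc h
    obtain ⟨V, hVW, hV⟩ := LinRel.exists_ofOpOn_of_ofOp hW
    exact ⟨⟨W, hWc, hW⟩, V, hVW.trans hWc, hV⟩
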